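/- Let $\beta:(0,\infty)\to(0,\infty)$ be a function with $\lim_{t\to\infty}\beta(t)=0$ and $t\beta(t)\ge 1$ for all $t\ge 1$. Then there exists a finite discrete Borel measure $\nu$ on $(0,\infty)$ (that is, a finite measure concentrated on a countable subset of $(0,\infty)$) such that $$\int_{(0,\infty)} t\,\beta(t)\,\nu(dt)<\infty$$ and the standard $p$-function $g\sim(0,\nu)$ has unbounded variation on $[0,\infty)$. Here, for $c\ge 0$ and a positive Borel measure $\nu$ on $(0,\infty)$ with $\int_{(0,\infty)}\frac{t}{1+t}\,\nu(dt)<\infty$, the standard $p$-function $g\sim(c,\nu)$ is the unique continuous function $g:[0,\infty)\to[0,1]$ with $g(0)=1$ and $$\int_0^\infty e^{-zt}g(t)\,dt=\frac{1}{z+c+\int_{(0,\infty)}(1-e^{-zt})\,\nu(dt)},\qquad \operatorname{Re} z>0 .$$ -/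

import Mathlib

open Set Filter Topology MeasureTheory

noncomputable section

/-- A measure on `ℝ` is a discrete measure on the set `A` if it is concentrated on
some countable subset of `A`, i.e. it is a countable combination of point masses in `A`. -/
def IsDiscreteMeasureOn (ν : Measure ℝ) (A : Set ℝ) : Prop :=
  ∃ S : Set ℝ, S.Countable ∧ S ⊆ A ∧ ν Sᶜ = 0

/-- `φ(z) = z + c + ∫_{(0,∞)} (1 - e^{-zt}) ν(dt)`. -/
def pFunctionExponent (c : ℝ) (ν : Measure ℝ) (z : ℂ) : ℂ :=
  z + (c : ℂ) + ∫ t in Ioi (0 : ℝ), (1 - Complex.exp (-z * (t : ℂ))) ∂ν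

/-- `g ∼ (c, ν)`: the function `g` is the standard `p`-function of the pair `(c, ν)`, where
`c ≥ 0` and `ν` satisfies `∫_{(0,∞)} t / (1 + t) ν(dt) < ∞`. That is, `g : [0,∞) → [0,1]` is
continuous, `g(0) = 1`, and its Laplace transform is `1 / φ` on the right half-plane.
Only the values of `g` on `[0,∞)` matter. -/
structure IsStandardPFunction (c : ℝ) (ν : Measure ℝ) (g : ℝ → ℝ) : Prop where
  c_nonneg : 0 ≤ c
  levy : ∫⁻ t in Ioi (0 : ℝ), ENNReal.ofReal (t / (1 + t)) ∂ν < ⊤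
  continuousOn : ContinuousOn g (Ici 0)
  mapsTo : MapsTo g (Ici 0) (Icc 0 1)
  map_zero : g 0 = 1
  laplace : ∀ z : ℂ, 0 < z.re →
    ∫ t in Ioi (0 : ℝ), Complex.exp (-z * (t : ℂ)) * (g t : ℂ) = 1 / pFunctionExponent c ν z

end

/-! Write `φ` for the exponent of `(0, ν)`. If `g` has total variation `V`, integration by parts
bounds `|z ĝ(z)|` by `V + 1` on `Re z > 0` (`norm_mul_laplace_le_of_boundedVariationOn`), so `|z| ≤
(V + 1) |φ(z)|`. For finite `ν` this extends by continuity to the imaginary axis. It therefore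
suffices to make `|φ(iy)| / y` arbitrarily small.

Take `ν = ∑ a k • δ_{t k}` with `t` very lacunary and put `D = 1 + ∑_{k<n} a k t k`. For `y` just
below `2π / t n`, write `y t n = 2π - ε`. The drift and the earlier atoms contribute about `i y D`,
the `n`-th atom about `-i ε a n`, and the later atoms almost nothing. Choosing `y D = ε a n` cancels
the main terms, and the error is `O(y / (n + 1))` once `a n t n ≥ (n + 1) D²`
(`exists_norm_seriesExponent_le`).

These conditions prescribe `a n t n` but let `t n` be as large as desired. Since `β → 0`, the `t n`
can be taken so large that `∑ a n t n β(t n)` converges.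

A `p`-function of `ν` exists because a renewal equation has a minimal nonnegative solution
(`isStandardPFunction_renewalReal`). -/

/-! ### Laplace transforms of functions of bounded variation. -/

theorem setIntegral_Ioi_comp_add_right {E : Type*} [NormedAddCommGroup E] [NormedSpace ℝ E]
    (F : ℝ → E) (h : ℝ) : ∫ t in Ioi (0 : ℝ), F (t + h) = ∫ t in Ioi h, F t := by
  have := (measurePreserving_add_right volume h).setIntegral_preimage_emb
    (measurableEmbedding_addRight h) F (Ioi h)
  simpa using this

theorem integrableOn_Ioi_comp_add_right {E : Type*} [NormedAddCommGroup E]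
    {F : ℝ → E} {h : ℝ} (hF : IntegrableOn F (Ioi h)) :
    IntegrableOn (fun t => F (t + h)) (Ioi 0) := by
  have := (measurePreserving_add_right volume h).integrableOn_comp_preimage
    (measurableEmbedding_addRight h) (f := F) (s := Ioi h)
  simpa [Function.comp_def] using this.2 hF

theorem integrableOn_exp_mul_of_bounded {z : ℂ} (hz : 0 < z.re) {f : ℝ → ℂ} {C : ℝ}
    (hf : AEStronglyMeasurable f (volume.restrict (Ioi 0)))
    (hC : ∀ t, 0 < t → ‖f t‖ ≤ C) :
    IntegrableOn (fun t : ℝ => Complex.exp (-z * t) * f t) (Ioi 0) := by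
  have h1 : IntegrableOn (fun t : ℝ => Complex.exp (-z * t)) (Ioi 0) :=
    integrableOn_exp_mul_complex_Ioi (by simpa using hz) 0
  exact h1.mul_bdd (c := C) hf ((ae_restrict_iff' measurableSet_Ioi).2 (.of_forall hC))

/-- A discrete integration by parts: dividing by `h` and letting `h → 0` replaces a Stieltjes
integral against `df`. -/
theorem laplace_shift_sub {z : ℂ} {f : ℝ → ℂ} {h : ℝ} (hh : 0 ≤ h)
    (hf : IntegrableOn (fun t : ℝ => Complex.exp (-z * t) * f t) (Ioi 0)) :
    IntegrableOn (fun t : ℝ => Complex.exp (-z * t) * (f (t + h) - f t)) (Ioi 0) ∧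
    ∫ t in Ioi (0 : ℝ), Complex.exp (-z * t) * (f (t + h) - f t) =
      (Complex.exp (z * h) - 1) * (∫ t in Ioi (0 : ℝ), Complex.exp (-z * t) * f t) -
        Complex.exp (z * h) * ∫ t in Ioc 0 h, Complex.exp (-z * t) * f t := by
  have hIoi : IntegrableOn (fun t : ℝ => Complex.exp (-z * t) * f t) (Ioi h) :=
    hf.mono_set (Ioi_subset_Ioi hh)
  have hfun : (fun t : ℝ => Complex.exp (-z * t) * f (t + h)) =
      fun t : ℝ => Complex.exp (z * h) *
        (Complex.exp (-z * (t + h : ℝ)) * f (t + h)) := by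
    ext t
    rw [← mul_assoc, ← Complex.exp_add]
    congr 2
    push_cast
    ring
  have h1 : IntegrableOn (fun t : ℝ => Complex.exp (-z * t) * f (t + h)) (Ioi 0) := by
    rw [hfun]
    exact (integrableOn_Ioi_comp_add_right hIoi).const_mul _
  have h2 : ∫ t in Ioi (0 : ℝ), Complex.exp (-z * t) * f (t + h) =
      Complex.exp (z * h) * ∫ t in Ioi h, Complex.exp (-z * t) * f t := by
    rw [hfun, integral_const_mul,
      setIntegral_Ioi_comp_add_right (fun t : ℝ => Complex.exp (-z * t) * f t) h]
  have h3 : ∫ t in Ioi (0 : ℝ), Complex.exp (-z * t) * f t =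
      (∫ t in Ioc 0 h, Complex.exp (-z * t) * f t) +
        ∫ t in Ioi h, Complex.exp (-z * t) * f t := by
    rw [← setIntegral_union (Ioc_disjoint_Ioi le_rfl) measurableSet_Ioi
      (hf.mono_set Ioc_subset_Ioi_self) hIoi, Ioc_union_Ioi_eq_Ioi hh]
  simp only [mul_sub]
  refine ⟨h1.sub hf, ?_⟩
  rw [integral_sub h1 hf, h2, h3]
  ring

theorem abs_sub_le_variationOnFromTo_sub {g : ℝ → ℝ} {s : Set ℝ}
    (hg : LocallyBoundedVariationOn g s) {a x y : ℝ} (ha : a ∈ s) (hx : x ∈ s) (hy : y ∈ s)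
    (hxy : x ≤ y) :
    |g y - g x| ≤ variationOnFromTo g s a y - variationOnFromTo g s a x := by
  have h1 := variationOnFromTo.add hg ha hx hy
  rw [← h1, add_sub_cancel_left, variationOnFromTo.eq_of_le _ _ hxy, ← Real.dist_eq, dist_comm,
    dist_edist]
  exact ENNReal.toReal_mono (hg x y hx hy) (eVariationOn.edist_le g ⟨hx, le_rfl, hxy⟩ ⟨hy, hxy, le_rfl⟩)

/-- Increments of `g` are dominated by those of its variation function `v`. Since `v` is real with
`0 ≤ v ≤ V`, `laplace_shift_sub` applied to `v` gives the bound. -/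
theorem norm_laplace_shift_sub_le {g : ℝ → ℝ} (hbv : BoundedVariationOn g (Ici 0)) {h : ℝ}
    (hh : 0 ≤ h) {z : ℂ} (hz : 0 < z.re) :
    ‖∫ t in Ioi (0 : ℝ), Complex.exp (-z * t) * ((g (t + h) : ℂ) - g t)‖ ≤
      (Real.exp (z.re * h) - 1) * ((eVariationOn g (Ici 0)).toReal / z.re) := by
  set V := (eVariationOn g (Ici 0)).toReal with hV
  set x := z.re with hx
  have hl := hbv.locallyBoundedVariationOn
  set v := variationOnFromTo g (Ici 0) 0 with hv
  have hv0 : ∀ t, 0 ≤ t → 0 ≤ v t := fun t ht => variationOnFromTo.nonneg_of_le _ _ ht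
  have hvV : ∀ t, 0 ≤ t → v t ≤ V := fun t ht => by
    rw [hv, variationOnFromTo.eq_of_le _ _ ht]
    exact ENNReal.toReal_mono hbv (eVariationOn.mono g inter_subset_left)
  have hvm : MonotoneOn v (Ici 0) := variationOnFromTo.monotoneOn hl (by simp)
  have hxz : 0 < (x : ℂ).re := hz
  have hvint : IntegrableOn (fun t : ℝ => Complex.exp (-(x : ℂ) * t) * (v t : ℂ)) (Ioi 0) := by
    refine integrableOn_exp_mul_of_bounded (C := V) hxz ?_ fun t ht => ?_
    · exact (Complex.measurable_ofReal.comp_aemeasurable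
        (aemeasurable_restrict_of_monotoneOn measurableSet_Ioi
          (hvm.mono Ioi_subset_Ici_self))).aestronglyMeasurable
    · rw [Complex.norm_real, Real.norm_of_nonneg (hv0 t ht.le)]
      exact hvV t ht.le
  have hvint' : IntegrableOn (fun t : ℝ => Real.exp (-x * t) * v t) (Ioi 0) := by
    have := hvint.re
    refine this.congr (.of_forall fun t => ?_)
    simp only [RCLike.re_to_complex]
    rw [show -(x : ℂ) * t = ((-x * t : ℝ) : ℂ) by push_cast; rfl, ← Complex.ofReal_exp,
      ← Complex.ofReal_mul, Complex.ofReal_re]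
  have cast : ∀ (w : ℝ → ℝ) (s : Set ℝ),
      ∫ t in s, Complex.exp (-(x : ℂ) * t) * (w t : ℂ) =
        ((∫ t in s, Real.exp (-x * t) * w t : ℝ) : ℂ) := fun w s => by
    rw [← integral_complex_ofReal]
    simp
  obtain ⟨hi1, he1⟩ := laplace_shift_sub (f := fun t => (v t : ℂ)) hh hvint
  have he2 : ∫ t in Ioi (0 : ℝ), Real.exp (-x * t) * (v (t + h) - v t) =
      (Real.exp (x * h) - 1) * (∫ t in Ioi (0 : ℝ), Real.exp (-x * t) * v t) -
        Real.exp (x * h) * ∫ t in Ioc 0 h, Real.exp (-x * t) * v t := by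
    rw [cast, cast] at he1
    have := cast (fun t => v (t + h) - v t) (Ioi 0)
    push_cast at this
    rw [this] at he1
    exact_mod_cast he1
  have hi2 : IntegrableOn (fun t : ℝ => Real.exp (-x * t) * (v (t + h) - v t)) (Ioi 0) := by
    refine hi1.re.congr (.of_forall fun t => ?_)
    simp only [RCLike.re_to_complex]
    rw [show -(x : ℂ) * t = ((-x * t : ℝ) : ℂ) by push_cast; rfl, ← Complex.ofReal_exp,
      ← Complex.ofReal_sub, ← Complex.ofReal_mul, Complex.ofReal_re]
  have hW : ∫ t in Ioi (0 : ℝ), Real.exp (-x * t) * v t ≤ V / x := by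
    calc ∫ t in Ioi (0 : ℝ), Real.exp (-x * t) * v t
        ≤ ∫ t in Ioi (0 : ℝ), Real.exp (-x * t) * V := by
          refine setIntegral_mono_on hvint' ((exp_neg_integrableOn_Ioi 0 hz).mul_const V)
            measurableSet_Ioi fun t ht => ?_
          have := hvV t (le_of_lt ht)
          gcongr
      _ = V / x := by
          rw [integral_mul_const, integral_exp_mul_Ioi (by simpa using hz)]
          simp
          ring
  calc _ ≤ ∫ t in Ioi (0 : ℝ), Real.exp (-x * t) * (v (t + h) - v t) := by
        refine norm_integral_le_of_norm_le hi2 ((ae_restrict_iff' measurableSet_Ioi).2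
          (.of_forall fun t ht => ?_))
        have ht : 0 < t := ht
        rw [norm_mul, Complex.norm_exp, ← Complex.ofReal_sub, Complex.norm_real, Real.norm_eq_abs]
        have h1 : (-z * t).re = -x * t := by simp [hx]
        rw [h1]
        gcongr
        exact abs_sub_le_variationOnFromTo_sub hl (by simp) ht.le
          (show (0 : ℝ) ≤ t + h by positivity) (by linarith)
    _ ≤ (Real.exp (x * h) - 1) * (∫ t in Ioi (0 : ℝ), Real.exp (-x * t) * v t) := by
        -- The boundary integral over `(0, h]` enters with a minus sign and is nonnegative, so it
        -- can be dropped.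
        rw [he2]
        have : 0 ≤ ∫ t in Ioc 0 h, Real.exp (-x * t) * v t :=
          setIntegral_nonneg measurableSet_Ioc fun t ht =>
            mul_nonneg (Real.exp_pos _).le (hv0 t ht.1.le)
        have := mul_nonneg (Real.exp_pos (x * h)).le this
        linarith
    _ ≤ _ := by
        gcongr
        have : 0 ≤ x * h := by positivity
        linarith [Real.add_one_le_exp (x * h)]

/-- The Laplace transform of a function of bounded variation, `[0,1]`-valued on `[0,∞)`, is
`O(1 / |z|)` uniformly on the right half-plane. -/
theorem norm_mul_laplace_le_of_boundedVariationOn {g : ℝ → ℝ}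
    (hbv : BoundedVariationOn g (Ici 0)) (hc : ContinuousOn g (Ici 0))
    (hm : MapsTo g (Ici 0) (Icc 0 1)) {z : ℂ} (hz : 0 < z.re) :
    ‖z * ∫ t in Ioi (0 : ℝ), Complex.exp (-z * t) * (g t : ℂ)‖ ≤
      (eVariationOn g (Ici 0)).toReal + 1 := by
  set V := (eVariationOn g (Ici 0)).toReal with hV
  have hg1 : ∀ t, 0 ≤ t → ‖(g t : ℂ)‖ ≤ 1 := fun t ht => by
    rw [Complex.norm_real, Real.norm_of_nonneg (hm ht).1]
    exact (hm ht).2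
  have hint : IntegrableOn (fun t : ℝ => Complex.exp (-z * t) * (g t : ℂ)) (Ioi 0) := by
    refine integrableOn_exp_mul_of_bounded (C := 1) hz ?_ fun t ht => hg1 t ht.le
    exact (Complex.continuous_ofReal.comp_continuousOn
      (hc.mono Ioi_subset_Ici_self)).aestronglyMeasurable measurableSet_Ioi
  set G := ∫ t in Ioi (0 : ℝ), Complex.exp (-z * t) * (g t : ℂ) with hG
  have key : ∀ h : ℝ, 0 < h →
      ‖(Complex.exp (z * h) - 1) / h * G‖ ≤
        (Real.exp (z.re * h) - 1) / h * (V / z.re) + Real.exp (z.re * h) := by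
    intro h hh
    have h1 := norm_laplace_shift_sub_le hbv hh.le hz
    rw [(laplace_shift_sub (f := fun t => (g t : ℂ)) hh.le hint).2, ← hG] at h1
    have h2 : ‖∫ t in Ioc 0 h, Complex.exp (-z * t) * (g t : ℂ)‖ ≤ h := by
      have := norm_setIntegral_le_of_norm_le_const (μ := volume) (s := Ioc 0 h) (C := 1)
        (f := fun t : ℝ => Complex.exp (-z * t) * (g t : ℂ)) (by simp) fun t ht => by
          rw [norm_mul, Complex.norm_exp]
          refine mul_le_one₀ (Real.exp_le_one_iff.2 ?_) (norm_nonneg _) (hg1 t ht.1.le)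
          simpa using mul_nonneg hz.le ht.1.le
      simpa [hh.le] using this
    have h3 : ‖Complex.exp (z * h)‖ = Real.exp (z.re * h) := by simp [Complex.norm_exp]
    have h4 : ‖(Complex.exp (z * h) - 1) * G‖ ≤
        (Real.exp (z.re * h) - 1) * (V / z.re) + Real.exp (z.re * h) * h := by
      refine (norm_le_norm_sub_add _ (Complex.exp (z * h) *
        ∫ t in Ioc 0 h, Complex.exp (-z * t) * (g t : ℂ))).trans (add_le_add h1 ?_)
      rw [norm_mul, h3]
      gcongr
    rw [div_mul_eq_mul_div, norm_div, Complex.norm_real, Real.norm_of_nonneg hh.le,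
      div_le_iff₀ hh]
    refine h4.trans (le_of_eq ?_)
    field_simp
  have hd1 : HasDerivAt (fun h : ℝ => Complex.exp (z * h)) z 0 := by
    have := (((hasDerivAt_id (0 : ℝ)).ofReal_comp).const_mul z).cexp
    simpa using this
  have hd2 : HasDerivAt (fun h : ℝ => Real.exp (z.re * h)) z.re 0 := by
    have := ((hasDerivAt_id (0 : ℝ)).const_mul z.re).exp
    simpa using this
  have ht1 : Tendsto (fun h : ℝ => (Complex.exp (z * h) - 1) / h) (𝓝[>] 0) (𝓝 z) := by
    have := hd1.tendsto_slope_zero_right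
    refine this.congr fun h => ?_
    simp [div_eq_inv_mul]
  have ht2 : Tendsto (fun h : ℝ => (Real.exp (z.re * h) - 1) / h) (𝓝[>] 0) (𝓝 z.re) := by
    have := hd2.tendsto_slope_zero_right
    refine this.congr fun h => ?_
    simp [div_eq_inv_mul]
  have ht3 : Tendsto (fun h : ℝ => Real.exp (z.re * h)) (𝓝[>] 0) (𝓝 1) := by
    have : ContinuousAt (fun h : ℝ => Real.exp (z.re * h)) 0 := by fun_prop
    simpa using this.tendsto.mono_left nhdsWithin_le_nhds
  -- As `h → 0+` the left side of `key` tends to `‖z * G‖` and the right side to `z.re * (V / z.re)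
  -- + 1`.
  have hlim := le_of_tendsto_of_tendsto ((ht1.mul_const G).norm)
    ((ht2.mul_const (V / z.re)).add ht3)
    (eventually_nhdsWithin_of_forall fun h hh => key h hh)
  rwa [mul_div_cancel₀ _ hz.ne'] at hlim

/-! ### Existence of the `p`-function of a finite measure, by a renewal equation. -/

section

open scoped ENNReal

noncomputable section

/-- The exponential kernel `r ↦ e^{-lam r}` on `[0,∞)`, extended by `0`. -/
def expKernel (lam r : ℝ) : ℝ≥0∞ :=
  (Ici (0 : ℝ)).indicator (fun r => ENNReal.ofReal (Real.exp (-lam * r))) r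

/-- One step of the monotone iteration solving the renewal equation
`g = k + k * (ν * g)` with `k` the exponential kernel whose rate is the total mass of `ν`. -/
def renewalStep (ν : Measure ℝ) (f : ℝ → ℝ≥0∞) (t : ℝ) : ℝ≥0∞ :=
  expKernel (ν.real univ) t +
    ∫⁻ s, expKernel (ν.real univ) (t - s) * ∫⁻ u, f (s - u) ∂ν

/-- The minimal nonnegative solution of the renewal equation. -/
def renewalSol (ν : Measure ℝ) (t : ℝ) : ℝ≥0∞ := ⨆ n, (renewalStep ν)^[n] 0 t

theorem measurable_expKernel (lam : ℝ) : Measurable (expKernel lam) :=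
  Measurable.indicator (by fun_prop) measurableSet_Ici

theorem measurable_lintegral_sub (ν : Measure ℝ) [IsFiniteMeasure ν] {f : ℝ → ℝ≥0∞}
    (hf : Measurable f) : Measurable fun s => ∫⁻ u, f (s - u) ∂ν :=
  Measurable.lintegral_prod_right' (f := fun p : ℝ × ℝ => f (p.1 - p.2)) (by fun_prop)

theorem measurable_renewalStep (ν : Measure ℝ) [IsFiniteMeasure ν] {f : ℝ → ℝ≥0∞}
    (hf : Measurable f) : Measurable (renewalStep ν f) := by
  have hk := measurable_expKernel (ν.real univ)
  have hF := measurable_lintegral_sub ν hf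
  exact hk.add (Measurable.lintegral_prod_right'
    (f := fun p : ℝ × ℝ => expKernel (ν.real univ) (p.1 - p.2) * ∫⁻ u, f (p.2 - u) ∂ν)
    ((hk.comp (by fun_prop)).mul (hF.comp measurable_snd)))

theorem monotone_renewalStep (ν : Measure ℝ) : Monotone (renewalStep ν) := by
  intro f f' h t
  unfold renewalStep
  gcongr with s u
  exact h _

theorem monotone_iterate_renewalStep (ν : Measure ℝ) :
    Monotone fun n => (renewalStep ν)^[n] 0 :=
  (monotone_renewalStep ν).monotone_iterate_of_le_map (zero_le)

theorem measurable_iterate_renewalStep (ν : Measure ℝ) [IsFiniteMeasure ν] (n : ℕ) :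
    Measurable ((renewalStep ν)^[n] 0) := by
  induction n with
  | zero => exact measurable_const
  | succ n ih =>
    rw [Function.iterate_succ_apply']
    exact measurable_renewalStep ν ih

theorem measurable_renewalSol (ν : Measure ℝ) [IsFiniteMeasure ν] : Measurable (renewalSol ν) :=
  Measurable.iSup fun n => measurable_iterate_renewalStep ν n

theorem renewalStep_renewalSol (ν : Measure ℝ) [IsFiniteMeasure ν] :
    renewalStep ν (renewalSol ν) = renewalSol ν := by
  ext t
  have hm := measurable_iterate_renewalStep ν
  have hmono := monotone_iterate_renewalStep ν
  have h1 : ∀ s, ∫⁻ u, renewalSol ν (s - u) ∂ν =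
      ⨆ n, ∫⁻ u, (renewalStep ν)^[n] 0 (s - u) ∂ν := fun s =>
    lintegral_iSup (fun n => (hm n).comp (by fun_prop)) fun i j hij u => hmono hij _
  have h2 : ∫⁻ s, expKernel (ν.real univ) (t - s) * ∫⁻ u, renewalSol ν (s - u) ∂ν =
      ⨆ n, ∫⁻ s, expKernel (ν.real univ) (t - s) *
        ∫⁻ u, (renewalStep ν)^[n] 0 (s - u) ∂ν := by
    simp_rw [h1, ENNReal.mul_iSup]
    refine lintegral_iSup (fun n => ?_) fun i j hij s => ?_
    · exact ((measurable_expKernel _).comp (by fun_prop)).mul (measurable_lintegral_sub ν (hm n))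
    · dsimp only
      gcongr with u
      exact hmono hij _
  rw [renewalStep, h2, ENNReal.add_iSup, renewalSol]
  have h3 : ∀ n, expKernel (ν.real univ) t + ∫⁻ s, expKernel (ν.real univ) (t - s) *
      ∫⁻ u, (renewalStep ν)^[n] 0 (s - u) ∂ν = (renewalStep ν)^[n + 1] 0 t := fun n => by
    rw [Function.iterate_succ_apply']
    rfl
  simp_rw [h3]
  -- Dropping the zeroth iterate does not change the supremum of an increasing sequence.
  exact Monotone.iSup_nat_add (f := fun n => (renewalStep ν)^[n] 0 t)
    (fun i j hij => hmono hij t) 1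

theorem lintegral_sub_eq_zero {ν : Measure ℝ} (hν : ν (Iic 0) = 0) {f : ℝ → ℝ≥0∞}
    (hf : ∀ t < 0, f t = 0) {s : ℝ} (hs : s < 0) : ∫⁻ u, f (s - u) ∂ν = 0 := by
  have h : ∀ᵐ u ∂ν, f (s - u) = 0 := by
    have : ∀ᵐ u ∂ν, u ∉ Iic (0 : ℝ) := measure_eq_zero_iff_ae_notMem.1 hν
    filter_upwards [this] with u hu
    exact hf _ (by have : 0 < u := not_le.1 hu; linarith)
  rw [lintegral_congr_ae h, lintegral_zero]

theorem renewalStep_eq_setLIntegral {ν : Measure ℝ} (hν : ν (Iic 0) = 0) {f : ℝ → ℝ≥0∞}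
    (hf : ∀ t < 0, f t = 0) (t : ℝ) :
    renewalStep ν f t = expKernel (ν.real univ) t +
      ∫⁻ s in Ioc 0 t, ENNReal.ofReal (Real.exp (-ν.real univ * (t - s))) *
        ∫⁻ u, f (s - u) ∂ν := by
  -- The integrand is known to vanish only for `s < 0` and `s > t`, so the null endpoint `0` is kept
  -- for the pointwise comparison.
  rw [renewalStep, setLIntegral_congr Ioc_ae_eq_Icc, ← lintegral_indicator measurableSet_Icc]
  congr 1
  refine lintegral_congr fun s => ?_
  rcases lt_or_ge s 0 with hs | hs
  · rw [lintegral_sub_eq_zero hν hf hs, mul_zero, indicator_of_notMem (by simp [hs])]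
  rcases lt_or_ge t s with hst | hst
  · rw [indicator_of_notMem (by simp [hst]), expKernel, indicator_of_notMem (by simp [hst]),
      zero_mul]
  · rw [indicator_of_mem (show s ∈ Icc 0 t from ⟨hs, hst⟩), expKernel,
      indicator_of_mem (by simpa using hst)]

theorem renewalStep_of_neg {ν : Measure ℝ} (hν : ν (Iic 0) = 0) {f : ℝ → ℝ≥0∞}
    (hf : ∀ t < 0, f t = 0) {t : ℝ} (ht : t < 0) : renewalStep ν f t = 0 := by
  rw [renewalStep_eq_setLIntegral hν hf, Ioc_eq_empty (by simpa using ht.le), expKernel,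
    indicator_of_notMem (by simpa using ht)]
  simp

theorem integral_mul_exp_neg_mul_sub (lam t : ℝ) :
    ∫ s in (0 : ℝ)..t, Real.exp (-lam * (t - s)) * lam = 1 - Real.exp (-lam * t) := by
  have h : ∀ s ∈ uIcc 0 t, HasDerivAt (fun s => Real.exp (-lam * (t - s)))
      (Real.exp (-lam * (t - s)) * lam) s := fun s _ => by
    have := (((hasDerivAt_id s).const_sub t).const_mul (-lam)).exp
    simpa using this
  rw [intervalIntegral.integral_eq_sub_of_hasDerivAt h
    (by apply Continuous.intervalIntegrable; fun_prop)]
  simp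

/-- With `lam` the total mass of `ν`, the inner integral is at most `lam`, and `e^{-lam t} + ∫₀ᵗ lam
e^{-lam (t - s)} ds = 1`. -/
theorem renewalStep_le_one {ν : Measure ℝ} [IsFiniteMeasure ν] (hν : ν (Iic 0) = 0)
    {f : ℝ → ℝ≥0∞} (hf : ∀ t < 0, f t = 0) (hf1 : ∀ t, f t ≤ 1) (t : ℝ) :
    renewalStep ν f t ≤ 1 := by
  rcases lt_or_ge t 0 with ht | ht
  · rw [renewalStep_of_neg hν hf ht]
    exact zero_le
  set lam := ν.real univ with hlam
  have hlam0 : 0 ≤ lam := measureReal_nonneg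
  rw [renewalStep_eq_setLIntegral hν hf, ← hlam]
  have h1 : ∫⁻ s in Ioc 0 t, ENNReal.ofReal (Real.exp (-lam * (t - s))) * ∫⁻ u, f (s - u) ∂ν ≤
      ENNReal.ofReal (1 - Real.exp (-lam * t)) := by
    rw [← integral_mul_exp_neg_mul_sub, intervalIntegral.integral_of_le ht,
      ofReal_integral_eq_lintegral_ofReal]
    · refine lintegral_mono fun s => ?_
      dsimp only
      rw [ENNReal.ofReal_mul (Real.exp_pos _).le]
      gcongr
      calc ∫⁻ u, f (s - u) ∂ν ≤ ∫⁻ u, 1 ∂ν := lintegral_mono fun u => hf1 _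
        _ = ENNReal.ofReal lam := by simp [hlam]
    · exact ((by fun_prop : Continuous fun s => Real.exp (-lam * (t - s)) * lam).integrableOn_Ioc)
    · exact .of_forall fun s => by positivity
  have h2 : Real.exp (-lam * t) ≤ 1 := Real.exp_le_one_iff.2 (by nlinarith)
  calc _ ≤ ENNReal.ofReal (Real.exp (-lam * t)) + ENNReal.ofReal (1 - Real.exp (-lam * t)) := by
        rw [expKernel, indicator_of_mem (by simpa using ht)]
        gcongr
    _ = 1 := by
        rw [← ENNReal.ofReal_add (Real.exp_pos _).le (by linarith)]
        simp

theorem iterate_renewalStep_bounds {ν : Measure ℝ} [IsFiniteMeasure ν] (hν : ν (Iic 0) = 0)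
    (n : ℕ) : (∀ t < 0, (renewalStep ν)^[n] 0 t = 0) ∧ ∀ t, (renewalStep ν)^[n] 0 t ≤ 1 := by
  induction n with
  | zero => simp
  | succ n ih =>
    rw [Function.iterate_succ_apply']
    exact ⟨fun t ht => renewalStep_of_neg hν ih.1 ht, renewalStep_le_one hν ih.1 ih.2⟩

theorem renewalSol_of_neg {ν : Measure ℝ} [IsFiniteMeasure ν] (hν : ν (Iic 0) = 0) {t : ℝ}
    (ht : t < 0) : renewalSol ν t = 0 := by
  simp [renewalSol, (iterate_renewalStep_bounds hν _).1 t ht]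

theorem renewalSol_le_one {ν : Measure ℝ} [IsFiniteMeasure ν] (hν : ν (Iic 0) = 0) (t : ℝ) :
    renewalSol ν t ≤ 1 :=
  iSup_le fun n => (iterate_renewalStep_bounds hν n).2 t

/-- The real-valued solution of the renewal equation. -/
def renewalReal (ν : Measure ℝ) (t : ℝ) : ℝ := (renewalSol ν t).toReal

theorem renewalReal_nonneg {ν : Measure ℝ} (t : ℝ) : 0 ≤ renewalReal ν t :=
  ENNReal.toReal_nonneg

/-- The convolution of a measure with the solution of the renewal equation. -/
def renewalConv (ν : Measure ℝ) (s : ℝ) : ℝ := ∫ u, renewalReal ν (s - u) ∂ν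

theorem renewalConv_nonneg {ν : Measure ℝ} (s : ℝ) : 0 ≤ renewalConv ν s :=
  integral_nonneg fun _ => renewalReal_nonneg _

section

variable {ν : Measure ℝ} [IsFiniteMeasure ν]

theorem measurable_renewalReal (ν : Measure ℝ) [IsFiniteMeasure ν] : Measurable (renewalReal ν) :=
  (measurable_renewalSol ν).ennreal_toReal

theorem renewalReal_le_one (hν : ν (Iic 0) = 0) (t : ℝ) : renewalReal ν t ≤ 1 :=
  ENNReal.toReal_le_of_le_ofReal zero_le_one (by simpa using renewalSol_le_one hν t)

theorem renewalReal_of_neg (hν : ν (Iic 0) = 0) {t : ℝ} (ht : t < 0) : renewalReal ν t = 0 := by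
  simp [renewalReal, renewalSol_of_neg hν ht]

theorem ofReal_renewalReal (hν : ν (Iic 0) = 0) (t : ℝ) :
    ENNReal.ofReal (renewalReal ν t) = renewalSol ν t :=
  ENNReal.ofReal_toReal ((renewalSol_le_one hν t).trans_lt ENNReal.one_lt_top).ne

theorem integrable_renewalReal_sub (hν : ν (Iic 0) = 0) (s : ℝ) :
    Integrable (fun u => renewalReal ν (s - u)) ν := by
  refine Integrable.of_bound (C := 1)
    ((measurable_renewalReal ν).comp (by fun_prop)).aestronglyMeasurable (.of_forall fun u => ?_)
  rw [Real.norm_of_nonneg (renewalReal_nonneg _)]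
  exact renewalReal_le_one hν _

theorem ofReal_renewalConv (hν : ν (Iic 0) = 0) (s : ℝ) :
    ENNReal.ofReal (renewalConv ν s) = ∫⁻ u, renewalSol ν (s - u) ∂ν := by
  rw [renewalConv, ofReal_integral_eq_lintegral_ofReal (integrable_renewalReal_sub hν s)
    (.of_forall fun u => renewalReal_nonneg _)]
  simp_rw [ofReal_renewalReal hν]

theorem renewalConv_le (hν : ν (Iic 0) = 0) (s : ℝ) : renewalConv ν s ≤ ν.real univ := by
  calc renewalConv ν s ≤ ∫ _, (1 : ℝ) ∂ν :=
        integral_mono (integrable_renewalReal_sub hν s) (integrable_const _)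
          fun u => renewalReal_le_one hν _
    _ = ν.real univ := by simp

theorem measurable_renewalConv (hν : ν (Iic 0) = 0) : Measurable (renewalConv ν) := by
  have h : renewalConv ν = fun s => (∫⁻ u, renewalSol ν (s - u) ∂ν).toReal := by
    ext s
    rw [← ofReal_renewalConv hν, ENNReal.toReal_ofReal (renewalConv_nonneg s)]
  rw [h]
  exact (measurable_lintegral_sub ν (measurable_renewalSol ν)).ennreal_toReal

theorem integrableOn_mul_renewalConv (hν : ν (Iic 0) = 0) {f : ℝ → ℝ} (hf : Continuous f)
    (a b : ℝ) : IntegrableOn (fun s => f s * renewalConv ν s) (Ioc a b) := by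
  refine Integrable.mul_bdd (c := ν.real univ) hf.integrableOn_Ioc
    (measurable_renewalConv hν).aestronglyMeasurable (.of_forall fun s => ?_)
  rw [Real.norm_of_nonneg (renewalConv_nonneg _)]
  exact renewalConv_le hν s

/-- The renewal equation. -/
theorem renewalReal_eq (hν : ν (Iic 0) = 0) {t : ℝ} (ht : 0 ≤ t) :
    renewalReal ν t = Real.exp (-ν.real univ * t) +
      ∫ s in (0 : ℝ)..t, Real.exp (-ν.real univ * (t - s)) * renewalConv ν s := by
  have hpos : ∀ s, 0 ≤ Real.exp (-ν.real univ * (t - s)) * renewalConv ν s := fun s =>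
    mul_nonneg (Real.exp_pos _).le (renewalConv_nonneg s)
  have h1 : renewalSol ν t = ENNReal.ofReal (Real.exp (-ν.real univ * t) +
      ∫ s in (0 : ℝ)..t, Real.exp (-ν.real univ * (t - s)) * renewalConv ν s) := by
    rw [← renewalStep_renewalSol ν,
      renewalStep_eq_setLIntegral hν (fun t ht => renewalSol_of_neg hν ht),
      ENNReal.ofReal_add (Real.exp_pos _).le (intervalIntegral.integral_nonneg ht fun s _ => hpos s),
      intervalIntegral.integral_of_le ht, ofReal_integral_eq_lintegral_ofReal
        (integrableOn_mul_renewalConv hν (by fun_prop) 0 t) (.of_forall hpos),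
      expKernel, indicator_of_mem (by simpa using ht)]
    simp_rw [ENNReal.ofReal_mul (Real.exp_pos _).le, ofReal_renewalConv hν]
  rw [renewalReal, h1, ENNReal.toReal_ofReal]
  exact add_nonneg (Real.exp_pos _).le (intervalIntegral.integral_nonneg ht fun s _ => hpos s)

theorem continuousOn_renewalReal (hν : ν (Iic 0) = 0) : ContinuousOn (renewalReal ν) (Ici 0) := by
  have hint : ∀ a b, IntervalIntegrable
      (fun s => Real.exp (ν.real univ * s) * renewalConv ν s) volume a b := fun a b =>
    ⟨integrableOn_mul_renewalConv hν (by fun_prop) a b,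
      integrableOn_mul_renewalConv hν (by fun_prop) b a⟩
  have hc : Continuous fun t => Real.exp (-ν.real univ * t) * (1 +
      ∫ s in (0 : ℝ)..t, Real.exp (ν.real univ * s) * renewalConv ν s) :=
    (by fun_prop : Continuous fun t => Real.exp (-ν.real univ * t)).mul
      (continuous_const.add (intervalIntegral.continuous_primitive hint 0))
  refine hc.continuousOn.congr fun t ht => ?_
  dsimp only
  rw [renewalReal_eq hν ht, mul_add, mul_one, ← intervalIntegral.integral_const_mul]
  congr 2
  ext s
  rw [← mul_assoc, ← Real.exp_add]
  ring_nf

theorem integrableOn_exp_mul_renewalReal (hν : ν (Iic 0) = 0) {z : ℂ} (hz : 0 < z.re) :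
    IntegrableOn (fun t : ℝ => Complex.exp (-z * t) * (renewalReal ν t : ℂ)) (Ioi 0) := by
  refine integrableOn_exp_mul_of_bounded (C := 1) hz
    (Complex.measurable_ofReal.comp (measurable_renewalReal ν)).aestronglyMeasurable fun t _ => ?_
  rw [Complex.norm_real, Real.norm_of_nonneg (renewalReal_nonneg _)]
  exact renewalReal_le_one hν t

theorem integrableOn_exp_mul_renewalConv (hν : ν (Iic 0) = 0) {z : ℂ} (hz : 0 < z.re) :
    IntegrableOn (fun t : ℝ => Complex.exp (-z * t) * (renewalConv ν t : ℂ)) (Ioi 0) := by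
  refine integrableOn_exp_mul_of_bounded (C := ν.real univ) hz
    (Complex.measurable_ofReal.comp (measurable_renewalConv hν)).aestronglyMeasurable fun t _ => ?_
  rw [Complex.norm_real, Real.norm_of_nonneg (renewalConv_nonneg _)]
  exact renewalConv_le hν t

theorem laplace_renewalReal_sub (hν : ν (Iic 0) = 0) {z : ℂ} {u : ℝ} (hu : 0 < u) :
    ∫ s in Ioi (0 : ℝ), Complex.exp (-z * s) * (renewalReal ν (s - u) : ℂ) =
      Complex.exp (-z * u) * ∫ t in Ioi (0 : ℝ), Complex.exp (-z * t) * (renewalReal ν t : ℂ) := by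
  have h1 : ∫ s in Ioi (0 : ℝ), Complex.exp (-z * s) * (renewalReal ν (s - u) : ℂ) =
      ∫ s in Ici u, Complex.exp (-z * s) * (renewalReal ν (s - u) : ℂ) := by
    refine setIntegral_eq_of_subset_of_forall_sdiff_eq_zero measurableSet_Ioi
      (Ici_subset_Ioi.2 hu) fun s hs => ?_
    rw [renewalReal_of_neg hν (by have : s < u := not_le.1 hs.2; linarith)]
    simp
  rw [h1, integral_Ici_eq_integral_Ioi, ← setIntegral_Ioi_comp_add_right, ← integral_const_mul]
  congr 1 with t
  rw [← mul_assoc, ← Complex.exp_add]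
  push_cast
  ring_nf

theorem laplace_renewalConv (hν : ν (Iic 0) = 0) {z : ℂ} (hz : 0 < z.re) :
    ∫ s in Ioi (0 : ℝ), Complex.exp (-z * s) * (renewalConv ν s : ℂ) =
      (∫ u, Complex.exp (-z * u) ∂ν) *
        ∫ t in Ioi (0 : ℝ), Complex.exp (-z * t) * (renewalReal ν t : ℂ) := by
  have h1 : ∀ s : ℝ, Complex.exp (-z * s) * (renewalConv ν s : ℂ) =
      ∫ u, Complex.exp (-z * s) * (renewalReal ν (s - u) : ℂ) ∂ν := fun s => by
    rw [renewalConv, ← integral_complex_ofReal, integral_const_mul]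
  simp_rw [h1]
  rw [integral_integral_swap, ← integral_mul_const]
  · refine integral_congr_ae ?_
    filter_upwards [measure_eq_zero_iff_ae_notMem.1 hν] with u hu
    exact laplace_renewalReal_sub hν (not_le.1 hu)
  -- Fubini is justified by the majorant `|e^{-zs}|`, integrable on the product because `ν` is
  -- finite.
  · have h2 : Integrable (fun p : ℝ × ℝ => Complex.exp (-z * p.1) * (1 : ℂ))
        ((volume.restrict (Ioi 0)).prod ν) :=
      Integrable.mul_prod (f := fun t : ℝ => Complex.exp (-z * t)) (g := fun _ => (1 : ℂ))
        (integrableOn_exp_mul_complex_Ioi (by simpa using hz) 0) (integrable_const _)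
    simp_rw [mul_one] at h2
    refine h2.mul_bdd (c := 1) ?_ (.of_forall fun p => ?_)
    · exact (Complex.measurable_ofReal.comp ((measurable_renewalReal ν).comp
        (by fun_prop))).aestronglyMeasurable
    · rw [Complex.norm_real, Real.norm_of_nonneg (renewalReal_nonneg _)]
      exact renewalReal_le_one hν _

/-- The renewal equation transforms into `G = (1 + N G) / (z + lam)`, with `G` and `N` the
transforms of `renewalReal ν` and `ν`. -/
theorem laplace_renewalReal (hν : ν (Iic 0) = 0) {z : ℂ} (hz : 0 < z.re) :
    (z + ν.real univ - ∫ u, Complex.exp (-z * u) ∂ν) *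
      ∫ t in Ioi (0 : ℝ), Complex.exp (-z * t) * (renewalReal ν t : ℂ) = 1 := by
  set lam := ν.real univ with hlam
  have hlam0 : 0 ≤ lam := measureReal_nonneg
  have hzl : (-(z + lam)).re < 0 := by
    simp
    linarith
  have hexp := integrableOn_exp_mul_complex_Ioi hzl 0
  have hexpint : ∫ t in Ioi (0 : ℝ), Complex.exp (-(z + lam) * t) = 1 / (z + lam) := by
    rw [integral_exp_mul_complex_Ioi hzl]
    rw [Complex.ofReal_zero, mul_zero, Complex.exp_zero, neg_div_neg_eq]
  have hF := integrableOn_exp_mul_renewalConv hν hz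
  have hconv := integral_posConvolution (μ := volume) (ν := volume) hF hexp
    (ContinuousLinearMap.mul ℝ ℂ)
  have h1 : ∀ t : ℝ, 0 < t → ∫ s in (0 : ℝ)..t, ContinuousLinearMap.mul ℝ ℂ
      (Complex.exp (-z * s) * (renewalConv ν s : ℂ)) (Complex.exp (-(z + lam) * (t - s : ℝ))) =
      Complex.exp (-z * t) * (renewalReal ν t : ℂ) - Complex.exp (-(z + lam) * t) := by
    intro t ht
    rw [renewalReal_eq hν ht.le, Complex.ofReal_add, mul_add, Complex.ofReal_exp,
      ← Complex.exp_add, ← intervalIntegral.integral_ofReal, ← intervalIntegral.integral_const_mul]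
    have : -z * t + ((-lam * t : ℝ) : ℂ) = -(z + lam) * t := by
      push_cast
      ring
    rw [this, add_sub_cancel_left]
    congr 1 with s
    rw [ContinuousLinearMap.mul_apply', Complex.ofReal_mul, Complex.ofReal_exp, ← mul_assoc,
      ← Complex.exp_add, mul_right_comm, ← Complex.exp_add]
    congr 2
    push_cast
    ring
  rw [setIntegral_congr_fun measurableSet_Ioi fun t ht => h1 t ht,
    integral_sub (integrableOn_exp_mul_renewalReal hν hz) hexp, hexpint,
    laplace_renewalConv hν hz, ContinuousLinearMap.mul_apply'] at hconv
  have hne : z + lam ≠ 0 := fun h => by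
    rw [h] at hzl
    simp at hzl
  generalize ∫ t in Ioi (0 : ℝ), Complex.exp (-z * t) * (renewalReal ν t : ℂ) = G at hconv ⊢
  generalize ∫ u, Complex.exp (-z * u) ∂ν = N at hconv ⊢
  field_simp at hconv
  linear_combination hconv

/-- Every finite measure on `(0,∞)` determines a standard `p`-function. -/
theorem isStandardPFunction_renewalReal (hν : ν (Iic 0) = 0) :
    IsStandardPFunction 0 ν (renewalReal ν) where
  c_nonneg := le_rfl
  levy := by
    calc ∫⁻ t in Ioi (0 : ℝ), ENNReal.ofReal (t / (1 + t)) ∂ν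
        ≤ ∫⁻ t in Ioi (0 : ℝ), 1 ∂ν := by
          refine setLIntegral_mono measurable_const fun t ht => ?_
          have ht : 0 < t := ht
          rw [ENNReal.ofReal_le_one, div_le_one (by positivity)]
          linarith
      _ < ⊤ := by simp
  continuousOn := continuousOn_renewalReal hν
  mapsTo := fun t _ => ⟨renewalReal_nonneg t, renewalReal_le_one hν t⟩
  map_zero := by
    rw [renewalReal_eq hν le_rfl]
    simp
  laplace := fun z hz => by
    have h1 : ν.restrict (Ioi 0) = ν := Measure.restrict_eq_self_of_ae_mem (by
      filter_upwards [measure_eq_zero_iff_ae_notMem.1 hν] with u hu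
      simpa using hu)
    have h2 : Integrable (fun t : ℝ => Complex.exp (-z * t)) ν := by
      refine Integrable.of_bound (C := 1) (by fun_prop) ?_
      filter_upwards [measure_eq_zero_iff_ae_notMem.1 hν] with u hu
      have hu : 0 < u := not_le.1 hu
      rw [Complex.norm_exp, Real.exp_le_one_iff]
      simpa using (mul_pos hz hu).le
    have h3 : pFunctionExponent 0 ν z = z + ν.real univ - ∫ u, Complex.exp (-z * u) ∂ν := by
      rw [pFunctionExponent, h1, integral_sub (integrable_const _) h2]
      simp
      ring
    rw [h3]
    exact eq_one_div_of_mul_eq_one_right (laplace_renewalReal hν hz)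

end

/-! ### Discrete measures, and the lower bound on the exponent forced by bounded variation. -/

/-- The discrete measure `∑ a k • δ_{t k}`. -/
def diracSeries (a t : ℕ → ℝ) : Measure ℝ :=
  Measure.sum fun k => ENNReal.ofReal (a k) • Measure.dirac (t k)

/-- The exponent `z + ∑ a k (1 - e^{-z t k})` of the measure `∑ a k • δ_{t k}`. -/
def seriesExponent (a t : ℕ → ℝ) (z : ℂ) : ℂ :=
  z + ∑' k, (a k : ℂ) * (1 - Complex.exp (-z * t k))

section

variable {a t : ℕ → ℝ}

theorem lintegral_diracSeries (f : ℝ → ℝ≥0∞) :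
    ∫⁻ x, f x ∂diracSeries a t = ∑' k, ENNReal.ofReal (a k) * f (t k) := by
  simp [diracSeries, lintegral_sum_measure]

theorem isFiniteMeasure_diracSeries (hs : Summable a) :
    IsFiniteMeasure (diracSeries a t) where
  measure_univ_lt_top := by
    simpa [diracSeries, Measure.sum_apply] using hs.tsum_ofReal_lt_top

theorem diracSeries_Iic (ht : ∀ k, 0 < t k) : diracSeries a t (Iic 0) = 0 := by
  simp [diracSeries, Measure.sum_apply, ht]

theorem isDiscreteMeasureOn_diracSeries (ht : ∀ k, 0 < t k) :
    IsDiscreteMeasureOn (diracSeries a t) (Ioi 0) := by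
  have hc : (range t).Countable := countable_range t
  refine ⟨range t, hc, range_subset_iff.2 ht, ?_⟩
  simp [diracSeries, Measure.sum_apply _ hc.measurableSet.compl]

theorem restrict_diracSeries (ht : ∀ k, 0 < t k) :
    (diracSeries a t).restrict (Ioi 0) = diracSeries a t :=
  Measure.restrict_eq_self_of_ae_mem (by
    filter_upwards [measure_eq_zero_iff_ae_notMem.1 (diracSeries_Iic (a := a) ht)] with u hu
    simpa using hu)

theorem norm_one_sub_exp_le {z : ℂ} (hz : 0 ≤ z.re) {u : ℝ} (hu : 0 ≤ u) :
    ‖1 - Complex.exp (-z * u)‖ ≤ 2 := by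
  have h : ‖Complex.exp (-z * u)‖ ≤ 1 := by
    rw [Complex.norm_exp, Real.exp_le_one_iff]
    simpa using mul_nonneg hz hu
  calc _ ≤ ‖(1 : ℂ)‖ + ‖Complex.exp (-z * u)‖ := norm_sub_le _ _
    _ ≤ 2 := by rw [norm_one]; linarith

theorem norm_coeff_mul_one_sub_exp_le (ha : ∀ k, 0 ≤ a k) (ht : ∀ k, 0 < t k) {z : ℂ}
    (hz : 0 ≤ z.re) (k : ℕ) : ‖(a k : ℂ) * (1 - Complex.exp (-z * t k))‖ ≤ a k * 2 := by
  rw [norm_mul, Complex.norm_real, Real.norm_of_nonneg (ha k)]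
  exact mul_le_mul_of_nonneg_left (norm_one_sub_exp_le hz (ht k).le) (ha k)

theorem pFunctionExponent_diracSeries (ha : ∀ k, 0 ≤ a k) (ht : ∀ k, 0 < t k) (hs : Summable a)
    {z : ℂ} (hz : 0 ≤ z.re) :
    pFunctionExponent 0 (diracSeries a t) z = seriesExponent a t z := by
  have := isFiniteMeasure_diracSeries (t := t) hs
  have hint : Integrable (fun u : ℝ => 1 - Complex.exp (-z * u)) (diracSeries a t) := by
    refine Integrable.of_bound (C := 2) (by fun_prop) ?_
    filter_upwards [measure_eq_zero_iff_ae_notMem.1 (diracSeries_Iic (a := a) ht)] with u hu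
    exact norm_one_sub_exp_le hz (by simpa using (not_le.1 (by simpa using hu : ¬ u ≤ 0)).le)
  rw [pFunctionExponent, restrict_diracSeries ht, seriesExponent]
  rw [diracSeries] at hint ⊢
  rw [← (hasSum_integral_measure hint).tsum_eq]
  simp [integral_smul_measure, ENNReal.toReal_ofReal, ha]

theorem continuousOn_seriesExponent (ha : ∀ k, 0 ≤ a k) (ht : ∀ k, 0 < t k) (hs : Summable a) :
    ContinuousOn (seriesExponent a t) {z | 0 ≤ z.re} := by
  refine continuousOn_id.add (continuousOn_tsum (fun k => ?_) (hs.mul_right 2) fun k z hz => ?_)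
  · fun_prop
  · exact norm_coeff_mul_one_sub_exp_le ha ht hz k

theorem norm_le_mul_norm_seriesExponent (ha : ∀ k, 0 ≤ a k) (ht : ∀ k, 0 < t k) (hs : Summable a)
    {g : ℝ → ℝ} (hg : IsStandardPFunction 0 (diracSeries a t) g)
    (hbv : BoundedVariationOn g (Ici 0)) {z : ℂ} (hz : 0 < z.re) :
    ‖z‖ ≤ ((eVariationOn g (Ici 0)).toReal + 1) * ‖seriesExponent a t z‖ := by
  have h1 := norm_mul_laplace_le_of_boundedVariationOn hbv hg.continuousOn hg.mapsTo hz
  rw [hg.laplace z hz, pFunctionExponent_diracSeries ha ht hs hz.le, mul_one_div, norm_div] at h1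
  have hre : ∀ k, 0 ≤ ((a k : ℂ) * (1 - Complex.exp (-z * t k))).re := fun k => by
    rw [Complex.re_ofReal_mul]
    refine mul_nonneg (ha k) ?_
    have h : ‖Complex.exp (-z * t k)‖ ≤ 1 := by
      rw [Complex.norm_exp, Real.exp_le_one_iff]
      simpa using (mul_pos hz (ht k)).le
    simpa using (Complex.re_le_norm _).trans h
  have hsum : Summable fun k => (a k : ℂ) * (1 - Complex.exp (-z * t k)) :=
    .of_norm_bounded (hs.mul_right 2) fun k => norm_coeff_mul_one_sub_exp_le ha ht hz.le k
  -- Every atom contributes a nonnegative real part, so the real part of the exponent is at least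
  -- `z.re`.
  have hpos : 0 < ‖seriesExponent a t z‖ := by
    refine norm_pos_iff.2 fun h0 => ?_
    have := congrArg Complex.re h0
    rw [seriesExponent, Complex.add_re, Complex.re_tsum hsum, Complex.zero_re] at this
    have hnn : 0 ≤ ∑' k, ((a k : ℂ) * (1 - Complex.exp (-z * t k))).re := tsum_nonneg hre
    linarith
  exact (div_le_iff₀ hpos).1 h1

/-- The previous bound extends to the imaginary axis. -/
theorem abs_le_mul_norm_seriesExponent (ha : ∀ k, 0 ≤ a k) (ht : ∀ k, 0 < t k) (hs : Summable a)
    {g : ℝ → ℝ} (hg : IsStandardPFunction 0 (diracSeries a t) g)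
    (hbv : BoundedVariationOn g (Ici 0)) (y : ℝ) :
    |y| ≤ ((eVariationOn g (Ici 0)).toReal + 1) * ‖seriesExponent a t (y * Complex.I)‖ := by
  have hline : Tendsto (fun x : ℝ => (x : ℂ) + y * Complex.I) (𝓝[>] 0)
      (𝓝[{z | 0 ≤ z.re}] (y * Complex.I)) := by
    refine tendsto_nhdsWithin_iff.2 ⟨?_, eventually_nhdsWithin_of_forall fun x hx => ?_⟩
    · have : ContinuousAt (fun x : ℝ => (x : ℂ) + y * Complex.I) 0 := by fun_prop
      simpa using this.tendsto.mono_left nhdsWithin_le_nhds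
    · have hx : 0 < x := hx
      simpa using hx.le
  have hexp := (continuousOn_seriesExponent ha ht hs (y * Complex.I) (by simp)).tendsto.comp hline
  have hid := (tendsto_nhdsWithin_iff.1 hline).1
  have := le_of_tendsto_of_tendsto hid.norm
    (hexp.norm.const_mul ((eVariationOn g (Ici 0)).toReal + 1))
    (eventually_nhdsWithin_of_forall fun x hx =>
      norm_le_mul_norm_seriesExponent ha ht hs hg hbv (by simpa using hx))
  simpa using this

/-! ### Cancellation in the exponent near a resonance. -/

/-- Taylor's bound for `|u| ≤ 1`; beyond that the triangle inequality gives `2 |u| ≤ 2 u²`. No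
smallness of `u` is needed. -/
theorem norm_exp_I_mul_sub_one_sub_le (u : ℝ) :
    ‖Complex.exp (Complex.I * u) - 1 - Complex.I * u‖ ≤ 2 * u ^ 2 := by
  have hn : ‖Complex.I * (u : ℂ)‖ = |u| := by simp
  rcases le_total |u| 1 with hu | hu
  · have := Complex.norm_exp_sub_one_sub_id_le (x := Complex.I * u) (by rwa [hn])
    rw [hn, sq_abs] at this
    nlinarith [sq_nonneg u]
  · have h1 : ‖Complex.exp (Complex.I * u) - 1‖ ≤ |u| := Real.norm_exp_I_mul_ofReal_sub_one_le
    have h2 := norm_sub_le (Complex.exp (Complex.I * u) - 1) (Complex.I * u)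
    rw [hn] at h2
    nlinarith [sq_abs u]

/-- Near resonance with the atom at `t n`, the exponent on the imaginary axis is much smaller
than its argument. -/
theorem exists_norm_seriesExponent_le (ha : ∀ k, 0 ≤ a k) (ht : ∀ k, 0 < t k) (hs : Summable a)
    (n : ℕ) {N D : ℝ} (hN : 1 ≤ N) (hD : D = 1 + ∑ k ∈ Finset.range n, a k * t k)
    (hlarge : N * D ^ 2 ≤ a n * t n) (hsep : ∀ k < n, N * D * t k ≤ t n)
    (htail : N * t n * ∑' k, a (k + (n + 1)) ≤ 1) :
    ∃ y : ℝ, 0 < y ∧ N * ‖seriesExponent a t (y * Complex.I)‖ ≤ 33 * y := by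
  have hD1 : 1 ≤ D := by
    rw [hD]
    exact le_add_of_nonneg_right (Finset.sum_nonneg fun k _ => mul_nonneg (ha k) (ht k).le)
  set b := a n * t n with hb
  have hbD : D ≤ b := by nlinarith
  have hbpos : 0 < b + D := by linarith
  have hapos : 0 < a n := by
    have : 0 < a n * t n := by linarith
    exact pos_of_mul_pos_left this (ht n).le
  have htn := ht n
  have hpi := Real.pi_gt_three
  have hpi4 := Real.pi_le_four
  -- `y` and `ε` solve the linear system `y * t n + ε = 2π`, `y * D = ε * a n`: phase just short of
  -- a full turn, and cancellation of first-order terms.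
  set y := 2 * Real.pi * a n / (b + D) with hy
  set ε := 2 * Real.pi * D / (b + D) with hε
  have hypos : 0 < y := by positivity
  have hεpos : 0 < ε := by positivity
  have hyε : y * t n + ε = 2 * Real.pi := by
    rw [hy, hε]
    field_simp
    rw [hb]
  have hyD : y * D = ε * a n := by
    rw [hy, hε]
    ring
  have hyt : 3 ≤ y * t n := by
    rw [hy, div_mul_eq_mul_div, le_div_iff₀ hbpos, mul_assoc, ← hb]
    nlinarith
  have hND : N * D * ε ≤ 8 := by
    rw [hε, ← mul_div_assoc, div_le_iff₀ hbpos]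
    nlinarith
  refine ⟨y, hypos, ?_⟩
  set f : ℕ → ℂ := fun k => (a k : ℂ) * (1 - Complex.exp (-(y * Complex.I) * t k)) with hf
  have hfn : ∀ k, ‖f k‖ ≤ a k * 2 := fun k => norm_coeff_mul_one_sub_exp_le ha ht (by simp) k
  have hsum : Summable f := .of_norm_bounded (hs.mul_right 2) hfn
  have hhead : ‖∑ k ∈ Finset.range n, f k - y * (D - 1) * Complex.I‖ ≤
      2 * y ^ 2 * ∑ k ∈ Finset.range n, a k * t k * t k := by
    have : (y : ℂ) * (D - 1) * Complex.I =
        ∑ k ∈ Finset.range n, (a k : ℂ) * (y * t k * Complex.I) := by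
      rw [hD]
      push_cast
      rw [add_sub_cancel_left, Finset.mul_sum, Finset.sum_mul]
      exact Finset.sum_congr rfl fun k _ => by ring
    rw [this, ← Finset.sum_sub_distrib, Finset.mul_sum]
    refine norm_sum_le_of_le _ fun k _ => ?_
    have h1 := norm_exp_I_mul_sub_one_sub_le (-(y * t k))
    have h2 : f k - (a k : ℂ) * (y * t k * Complex.I) = -(a k : ℂ) *
        (Complex.exp (Complex.I * (-(y * t k) : ℝ)) - 1 - Complex.I * (-(y * t k) : ℝ)) := by
      rw [hf]
      dsimp only
      rw [show Complex.I * ((-(y * t k) : ℝ) : ℂ) = -(y * Complex.I) * t k by push_cast; ring]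
      ring
    rw [h2, norm_mul, norm_neg, Complex.norm_real, Real.norm_of_nonneg (ha k)]
    calc _ ≤ a k * (2 * (-(y * t k)) ^ 2) := mul_le_mul_of_nonneg_left h1 (ha k)
      _ = _ := by ring
  have hmid : ‖f n + ε * a n * Complex.I‖ ≤ 2 * a n * ε ^ 2 := by
    have h1 := norm_exp_I_mul_sub_one_sub_le ε
    have h0 : Complex.exp (-(y * Complex.I) * t n) = Complex.exp (Complex.I * ε) := by
      rw [← Complex.exp_periodic.sub_eq (Complex.I * ε)]
      congr 1
      have : (y : ℂ) * t n + ε = 2 * Real.pi := by exact_mod_cast hyε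
      linear_combination -Complex.I * this
    have h2 : f n + ε * a n * Complex.I = -(a n : ℂ) *
        (Complex.exp (Complex.I * ε) - 1 - Complex.I * ε) := by
      rw [hf]
      dsimp only
      rw [h0]
      ring
    rw [h2, norm_mul, norm_neg, Complex.norm_real, Real.norm_of_nonneg (ha n)]
    calc _ ≤ a n * (2 * ε ^ 2) := mul_le_mul_of_nonneg_left h1 (ha n)
      _ = _ := by ring
  have hrest : ‖∑' k, f (k + (n + 1))‖ ≤ (∑' k, a (k + (n + 1))) * 2 := by
    have hs' : Summable fun k => a (k + (n + 1)) := (summable_nat_add_iff (n + 1)).2 hs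
    rw [← tsum_mul_right]
    exact tsum_of_norm_bounded (hs'.mul_right 2).hasSum fun k => hfn _
  -- The subtracted and added linear terms, together with the drift `i y`, sum to `i (y D - ε a n) =
  -- 0`.
  have hdecomp : seriesExponent a t (y * Complex.I) =
      (∑ k ∈ Finset.range n, f k - y * (D - 1) * Complex.I) + (f n + ε * a n * Complex.I) +
        ∑' k, f (k + (n + 1)) := by
    have : (y : ℂ) * D = ε * a n := by exact_mod_cast hyD
    rw [seriesExponent, ← hsum.sum_add_tsum_nat_add (n + 1), Finset.sum_range_succ]
    linear_combination Complex.I * this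
  have hS : N * ∑ k ∈ Finset.range n, a k * t k * t k ≤ t n := by
    have h1 : N * D * ∑ k ∈ Finset.range n, a k * t k * t k ≤ t n * D := by
      calc _ = ∑ k ∈ Finset.range n, a k * t k * (N * D * t k) := by
            rw [Finset.mul_sum]
            exact Finset.sum_congr rfl fun k _ => by ring
        _ ≤ ∑ k ∈ Finset.range n, a k * t k * t n := Finset.sum_le_sum fun k hk =>
            mul_le_mul_of_nonneg_left (hsep k (Finset.mem_range.1 hk))
              (mul_nonneg (ha k) (ht k).le)
        _ = t n * (D - 1) := by rw [← Finset.sum_mul, hD]; ring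
        _ ≤ t n * D := by nlinarith
    exact le_of_mul_le_mul_right (by linarith) (by linarith : 0 < D)
  -- The constant `33` is `16 + 16 + 1`, from the earlier atoms, the resonant atom and the tail;
  -- each `16` is `2 * 8`, with `8` bounding `2π`.
  have e1 : N * (2 * y ^ 2 * ∑ k ∈ Finset.range n, a k * t k * t k) ≤ 16 * y := by
    calc _ = 2 * y ^ 2 * (N * ∑ k ∈ Finset.range n, a k * t k * t k) := by ring
      _ ≤ 2 * y ^ 2 * t n := by gcongr
      _ = 2 * y * (y * t n) := by ring
      _ ≤ 2 * y * 8 := by gcongr; linarith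
      _ = 16 * y := by ring
  have e2 : N * (2 * a n * ε ^ 2) ≤ 16 * y := by
    calc _ = 2 * N * ε * (ε * a n) := by ring
      _ = 2 * y * (N * D * ε) := by rw [← hyD]; ring
      _ ≤ 2 * y * 8 := by gcongr
      _ = 16 * y := by ring
  have e3 : N * ((∑' k, a (k + (n + 1))) * 2) ≤ y := by
    -- After multiplication by `t n` the left side is at most `2` by `htail`, while `y * t n ≥ 3`.
    refine le_of_mul_le_mul_right ?_ htn
    linarith
  calc N * ‖seriesExponent a t (y * Complex.I)‖
      ≤ N * (2 * y ^ 2 * ∑ k ∈ Finset.range n, a k * t k * t k + 2 * a n * ε ^ 2 +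
          (∑' k, a (k + (n + 1))) * 2) := by
        gcongr
        rw [hdecomp]
        exact norm_add₃_le.trans (add_le_add_three hhead hmid hrest)
    _ ≤ 33 * y := by linarith

/-- Criterion for unbounded variation: resonances of unbounded quality. -/
theorem not_boundedVariationOn_of_resonances (ha : ∀ k, 0 ≤ a k) (ht : ∀ k, 0 < t k)
    (hs : Summable a) (hsep : ∀ n : ℕ, ∀ k < n,
      (n + 1 : ℝ) * (1 + ∑ k ∈ Finset.range n, a k * t k) * t k ≤ t n)
    (hlarge : ∀ n : ℕ, (n + 1 : ℝ) * (1 + ∑ k ∈ Finset.range n, a k * t k) ^ 2 ≤ a n * t n)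
    (htail : ∀ n : ℕ, (n + 1 : ℝ) * t n * ∑' k, a (k + (n + 1)) ≤ 1)
    {g : ℝ → ℝ} (hg : IsStandardPFunction 0 (diracSeries a t) g) :
    ¬ BoundedVariationOn g (Ici 0) := by
  intro hbv
  set V := (eVariationOn g (Ici 0)).toReal with hV
  have hV0 : 0 ≤ V := ENNReal.toReal_nonneg
  obtain ⟨n, hn⟩ := exists_nat_gt (33 * (V + 1))
  obtain ⟨y, hy, hle⟩ := exists_norm_seriesExponent_le ha ht hs n (N := n + 1) (by simp) rfl
    (hlarge n) (hsep n) (htail n)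
  have h1 := abs_le_mul_norm_seriesExponent ha ht hs hg hbv y
  rw [← hV, abs_of_pos hy] at h1
  have h2 : (n + 1 : ℝ) * y ≤ 33 * (V + 1) * y := by
    calc (n + 1 : ℝ) * y ≤ (n + 1) * ((V + 1) * ‖seriesExponent a t (y * Complex.I)‖) := by gcongr
      _ = (V + 1) * ((n + 1) * ‖seriesExponent a t (y * Complex.I)‖) := by ring
      _ ≤ (V + 1) * (33 * y) := by gcongr
      _ = _ := by ring
  linarith [le_of_mul_le_mul_right h2 hy]

end

/-! ### Choice of the atoms and conclusion. -/

/-- The growth sequence `D 0 = 1`, `D (n + 1) = D n + (n + 1) (D n)²`. -/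
def growthSeq : ℕ → ℝ
  | 0 => 1
  | n + 1 => growthSeq n + (n + 1) * growthSeq n ^ 2

/-- The increments of the growth sequence. -/
def growthInc (n : ℕ) : ℝ := (n + 1) * growthSeq n ^ 2

theorem growthSeq_eq_sum (n : ℕ) : growthSeq n = 1 + ∑ k ∈ Finset.range n, growthInc k := by
  induction n with
  | zero => simp [growthSeq]
  | succ n ih => rw [Finset.sum_range_succ, ← add_assoc, ← ih, growthSeq, growthInc]

theorem one_le_growthSeq (n : ℕ) : 1 ≤ growthSeq n := by
  rw [growthSeq_eq_sum]
  exact le_add_of_nonneg_right (Finset.sum_nonneg fun k _ => by unfold growthInc; positivity)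

theorem growthSeq_le_growthInc (n : ℕ) : growthSeq n ≤ growthInc n := by
  have h := one_le_growthSeq n
  have : (0 : ℝ) ≤ n := n.cast_nonneg
  unfold growthInc
  nlinarith [mul_nonneg this (sq_nonneg (growthSeq n))]

/-- Each bound on `β` holds eventually, so every new point can be taken beyond any multiple of the
previous one. -/
theorem exists_sparse_seq {β : ℝ → ℝ} (hlim : Tendsto β atTop (𝓝 0)) {c K : ℕ → ℝ}
    (hc : ∀ n, 0 < c n) : ∃ t : ℕ → ℝ, 1 ≤ t 0 ∧ (∀ n, K n * t n ≤ t (n + 1)) ∧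
      ∀ n, β (t n) ≤ c n := by
  have hex : ∀ (n : ℕ) (T : ℝ), ∃ t, T ≤ t ∧ β t ≤ c n := fun n T =>
    ((eventually_ge_atTop T).and (hlim.eventually_le_const (hc n))).exists
  choose f hf using hex
  refine ⟨fun n => Nat.rec (f 0 1) (fun n T => f (n + 1) (K n * T)) n, (hf 0 1).1,
    fun n => (hf _ _).1, fun n => ?_⟩
  cases n
  · exact (hf _ _).2
  · exact (hf _ _).2

end

end

theorem theorem6p1 (β : ℝ → ℝ) (hpos : ∀ t : ℝ, 0 < t → 0 < β t)
    (hlim : Tendsto β atTop (𝓝 0)) (hge : ∀ t : ℝ, 1 ≤ t → 1 ≤ t * β t) :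
    ∃ ν : Measure ℝ, IsFiniteMeasure ν ∧ IsDiscreteMeasureOn ν (Ioi 0) ∧
      ∫⁻ t in Ioi (0 : ℝ), ENNReal.ofReal (t * β t) ∂ν < ⊤ ∧
      (∃ g : ℝ → ℝ, IsStandardPFunction 0 ν g) ∧
      ∀ g : ℝ → ℝ, IsStandardPFunction 0 ν g → ¬ BoundedVariationOn g (Ici 0) := by
  have hB1 : ∀ n, 1 ≤ growthInc n := fun n => (one_le_growthSeq n).trans (growthSeq_le_growthInc n)
  have hBpos : ∀ n, 0 < growthInc n := fun n => one_pos.trans_le (hB1 n)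
  -- `c` makes `a n * t n * β (t n) ≤ 2⁻ⁿ`. In `K`, the power of two gives geometric tails, the
  -- linear factor is the resonance quality, and `growthInc` is both the numerator of `a` and a
  -- bound for `D`.
  obtain ⟨t, ht0, htK, htβ⟩ := exists_sparse_seq hlim (c := fun n => (1 / 2) ^ n / growthInc n)
    (K := fun n => 2 ^ (n + 1) * ((n + 1 : ℕ) + 1) * growthInc (n + 1))
    (fun n => div_pos (by positivity) (hBpos n))
  have hK1 : ∀ n : ℕ, 1 ≤ (2 : ℝ) ^ n * (n + 1) * growthInc n := fun n =>
    one_le_mul_of_one_le_of_one_le (one_le_mul_of_one_le_of_one_le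
      (one_le_pow₀ one_le_two) (by simp)) (hB1 n)
  have ht1 : ∀ n, 1 ≤ t n := fun n => by
    induction n with
    | zero => exact ht0
    | succ n ih => exact (one_le_mul_of_one_le_of_one_le (hK1 (n + 1)) ih).trans (htK n)
  have ht : ∀ n, 0 < t n := fun n => one_pos.trans_le (ht1 n)
  have hmono : Monotone t := monotone_nat_of_le_succ fun n =>
    (le_mul_of_one_le_left (ht n).le (hK1 (n + 1))).trans (htK n)
  have hgap : ∀ n k : ℕ, n < k → 2 ^ k * (k + 1) * growthInc k * t n ≤ t k := by
    intro n k hnk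
    obtain ⟨m, rfl⟩ := Nat.exists_eq_succ_of_ne_zero (Nat.ne_zero_of_lt hnk)
    refine le_trans ?_ (htK m)
    exact mul_le_mul_of_nonneg_left (hmono (Nat.le_of_lt_succ hnk))
      (zero_le_one.trans (hK1 (m + 1)))
  -- With these masses `D` is `growthSeq n` and the condition `(n + 1) D² ≤ a n * t n` holds with
  -- equality.
  set a : ℕ → ℝ := fun n => growthInc n / t n with ha_def
  have ha : ∀ n, 0 ≤ a n := fun n => (div_pos (hBpos n) (ht n)).le
  have hat : ∀ n, a n * t n = growthInc n := fun n => div_mul_cancel₀ _ (ht n).ne'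
  have hasmall : ∀ n k : ℕ, n < k → (n + 1) * t n * a k ≤ (1 / 2) ^ k := by
    intro n k hnk
    have hnk' : (n : ℝ) ≤ k := by exact_mod_cast hnk.le
    rw [ha_def, ← mul_div_assoc, div_le_iff₀ (ht k), one_div, inv_pow, inv_mul_eq_div,
      le_div_iff₀ (by positivity)]
    refine le_trans ?_ (hgap n k hnk)
    have := mul_nonneg (mul_nonneg (sub_nonneg.2 hnk') (ht n).le)
      (mul_nonneg (hBpos k).le (by positivity : (0 : ℝ) ≤ 2 ^ k))
    linarith
  have hs : Summable a := by
    rw [← summable_nat_add_iff 1]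
    refine Summable.of_nonneg_of_le (fun n => ha _) (fun n => ?_)
      ((summable_nat_add_iff 1).2 summable_geometric_two)
    refine le_trans (le_mul_of_one_le_left (ha _) ?_) (hasmall 0 (n + 1) n.succ_pos)
    simpa using ht1 0
  have hsum : ∀ n, 1 + ∑ k ∈ Finset.range n, a k * t k = growthSeq n := fun n => by
    rw [growthSeq_eq_sum, Finset.sum_congr rfl fun k _ => hat k]
  have hfin := isFiniteMeasure_diracSeries (t := t) hs
  refine ⟨diracSeries a t, hfin, isDiscreteMeasureOn_diracSeries ht, ?_,
    ⟨_, isStandardPFunction_renewalReal (diracSeries_Iic ht)⟩,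
    fun g hg => not_boundedVariationOn_of_resonances ha ht hs (fun n k hk => ?_) (fun n => ?_)
      (fun n => ?_) hg⟩
  · rw [restrict_diracSeries ht, lintegral_diracSeries]
    calc ∑' k, ENNReal.ofReal (a k) * ENNReal.ofReal (t k * β (t k))
        ≤ ∑' k, ENNReal.ofReal ((1 / 2) ^ k) := by
          refine ENNReal.tsum_le_tsum fun k => ?_
          rw [← ENNReal.ofReal_mul (ha k), ← mul_assoc, hat]
          refine ENNReal.ofReal_le_ofReal ?_
          rw [← le_div_iff₀' (hBpos k)]
          exact htβ k
      _ < ⊤ := summable_geometric_two.tsum_ofReal_lt_top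
  · rw [hsum]
    refine le_trans (mul_le_mul_of_nonneg_right ?_ (ht k).le) (hgap k n hk)
    have h2 : (1 : ℝ) ≤ 2 ^ n := one_le_pow₀ one_le_two
    have h3 : (0 : ℝ) ≤ n + 1 := by positivity
    calc (n + 1 : ℝ) * growthSeq n ≤ (n + 1) * growthInc n :=
          mul_le_mul_of_nonneg_left (growthSeq_le_growthInc n) h3
      _ ≤ 2 ^ n * ((n + 1) * growthInc n) :=
          le_mul_of_one_le_left (mul_nonneg h3 (hBpos n).le) h2
      _ = _ := by ring
  · rw [hsum, hat, growthInc]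
  · have hs' : Summable fun k => a (k + (n + 1)) := (summable_nat_add_iff (n + 1)).2 hs
    rw [← tsum_mul_left]
    -- The tail starts at index `n + 1 ≥ 1`, so the dominating geometric series starts at `1/2` and
    -- sums to exactly `1`.
    have hgeo : HasSum (fun k : ℕ => (1 / 2 : ℝ) ^ k * (1 / 2)) 1 := by
      simpa using hasSum_geometric_two.mul_right (1 / 2 : ℝ)
    refine hasSum_le (fun k => ?_) (hs'.mul_left _).hasSum hgeo
    refine (hasmall n (k + (n + 1)) (by lia)).trans ?_
    rw [← pow_succ]
    exact pow_le_pow_of_le_one (by norm_num) (by norm_num) (by lia)
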